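/- A binary matrix $A\in\{0,1\}^{m\times n}$ is regarded as the bipartite graph whose edges are the positions $(i,j)$ with $A_{ij}=1$. A biclique of $A$ is a pair of nonempty sets $S$ of rows and $T$ of columns with $A_{ij}=1$ for all $i\in S$, $j\in T$; it contains the edges in $S\times T$. Let $M$ be the $0/1$ incidence matrix with a row for each edge and a column for each of the $N$ bicliques of $A$, and put $$\mathsf{bp}(A)=\min\{\mathbf 1^Tx: Mx=\mathbf 1,\ x\in\{0,1\}^N\},\quad \mathsf{bp}_f(A)=\min\{\mathbf 1^Tx: Mx=\mathbf 1,\ x\ge 0\},\quad \mathsf{bc}_f(A)=\min\{\mathbf 1^Tx: Mx\ge\mathbf 1,\ x\ge 0\}$$ (the biclique partition number, or binary rank; the fractional biclique partition number, or fractional binary rank; and the fractional biclique cover number, or fractional Boolean rank). Let $i(A)$ be the largest size of a set of ones of $A$ no two of which lie in a common all-ones submatrix of $A$. Let $A^{\otimes k}$ denote the $k$-th Kronecker power of $A$. **Theorem.** For every binary matrix $A$ the limit $$\mathsf{bp}_f^\infty(A)=\lim_{k\to\infty}\mathsf{bp}_f(A^{\otimes k})^{1/k}$$ exists, and $$i(A)\le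 \mathsf{bc}_f(A)\le \mathsf{bp}_f^\infty(A)\le \mathsf{bp}_f(A)\le \mathsf{bp}(A).$$ For the Domino matrix $$D=\begin{pmatrix}1&1&0\\1&1&1\\0&1&1\end{pmatrix}$$ one has $2\le \mathsf{bp}_f^\infty(D)\le 2.372713$. -/

import Mathlib

open Filter Topology
open scoped Matrix Kronecker

namespace BinMat

/-- A binary matrix: every entry is `0` or `1`. -/
def IsBinary {m n : Type*} (A : Matrix m n ℕ) : Prop := ∀ i j, A i j = 0 ∨ A i j = 1

/-- The `k`-th Kronecker power. Rows and columns are indexed by `k`-tuples. -/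
def kronPow {m n : Type*} (A : Matrix m n ℕ) (k : ℕ) : Matrix (Fin k → m) (Fin k → n) ℕ :=
  fun i j => ∏ t, A (i t) (j t)

theorem kronPow_succ {m n : Type*} (A : Matrix m n ℕ) (k : ℕ) :
    kronPow A (k + 1) = (A ⊗ₖ kronPow A k).submatrix
      (fun i => (i 0, Fin.tail i)) (fun j => (j 0, Fin.tail j)) := by
  ext i j
  simp [kronPow, Fin.prod_univ_succ, Matrix.kroneckerMap_apply, Fin.tail]

theorem kronPow_zero {m n : Type*} (A : Matrix m n ℕ) : kronPow A 0 = fun _ _ => 1 := by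
  ext i j
  simp [kronPow]

theorem IsBinary.kronPow {m n : Type*} {A : Matrix m n ℕ} (hA : IsBinary A) (k : ℕ) :
    IsBinary (kronPow A k) := by
  intro i j
  by_cases h : ∃ t, A (i t) (j t) = 0
  · obtain ⟨t, ht⟩ := h
    exact Or.inl (Finset.prod_eq_zero (Finset.mem_univ t) ht)
  · push Not at h
    exact Or.inr (Finset.prod_eq_one fun t _ => (hA _ _).resolve_left (h t))

variable {m n : Type*} [Fintype m] [Fintype n]

/-- The edges of the bipartite graph of `A`: the positions of its ones. -/
abbrev Edge (A : Matrix m n ℕ) : Type _ := {e : m × n // A e.1 e.2 = 1}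

/-- The bicliques of the bipartite graph of `A`, given by their two (nonempty) vertex sets;
equivalently, the all-ones submatrices of `A`. -/
abbrev Biclique (A : Matrix m n ℕ) : Type _ :=
  {B : Finset m × Finset n // B.1.Nonempty ∧ B.2.Nonempty ∧ ∀ i ∈ B.1, ∀ j ∈ B.2, A i j = 1}

noncomputable instance (A : Matrix m n ℕ) : Fintype (Edge A) := Fintype.ofFinite _

noncomputable instance (A : Matrix m n ℕ) : Fintype (Biclique A) := Fintype.ofFinite _

/-- The edge `e` lies in the biclique `B`. -/
def Covers {A : Matrix m n ℕ} (B : Biclique A) (e : m × n) : Prop :=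
  e.1 ∈ B.1.1 ∧ e.2 ∈ B.1.2

open Classical in
/-- The edge-biclique incidence matrix. -/
noncomputable def incidence (A : Matrix m n ℕ) : Matrix (Edge A) (Biclique A) ℝ :=
  fun e B => if Covers B e.1 then 1 else 0

/-- Fractional biclique partitions: `M x = 1`, `x ≥ 0`. -/
def fracPartitions (A : Matrix m n ℕ) : Set (Biclique A → ℝ) :=
  {x | 0 ≤ x ∧ incidence A *ᵥ x = 1}

/-- Fractional biclique covers: `M x ≥ 1`, `x ≥ 0`. -/
def fracCovers (A : Matrix m n ℕ) : Set (Biclique A → ℝ) :=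
  {x | 0 ≤ x ∧ 1 ≤ incidence A *ᵥ x}

/-- Biclique partitions: `M x = 1`, `x` a `0/1` vector. -/
def partitions (A : Matrix m n ℕ) : Set (Biclique A → ℝ) :=
  {x | (∀ B, x B = 0 ∨ x B = 1) ∧ incidence A *ᵥ x = 1}

/-- The total weight `1ᵀ x`. -/
noncomputable def weight {A : Matrix m n ℕ} (x : Biclique A → ℝ) : ℝ := ∑ B, x B

/-- The biclique partition number (binary rank). -/
noncomputable def bp (A : Matrix m n ℕ) : ℝ := sInf (weight '' partitions A)

/-- The fractional biclique partition number (fractional binary rank). -/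
noncomputable def bpF (A : Matrix m n ℕ) : ℝ := sInf (weight '' fracPartitions A)

/-- The fractional biclique cover number (fractional Boolean rank). -/
noncomputable def bcF (A : Matrix m n ℕ) : ℝ := sInf (weight '' fracCovers A)

/-- A set of ones of `A` is isolated (a fooling set) if no two of them lie in a common
all-ones submatrix. -/
def IsIsolated (A : Matrix m n ℕ) (F : Finset (m × n)) : Prop :=
  (∀ e ∈ F, A e.1 e.2 = 1) ∧
    ∀ e ∈ F, ∀ f ∈ F, e ≠ f → ¬ ∃ B : Biclique A, Covers B e ∧ Covers B f

open Classical in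
/-- The isolation number: the largest size of an isolated set of ones. -/
noncomputable def isoNum (A : Matrix m n ℕ) : ℕ :=
  (Finset.univ.filter (IsIsolated A)).sup Finset.card

/-- The asymptotic fractional binary rank `lim_k bpF(A^{⊗k})^{1/k}`. -/
noncomputable def bpFInf (A : Matrix m n ℕ) : ℝ :=
  limUnder atTop fun k : ℕ => bpF (kronPow A k) ^ (1 / (k : ℝ))

/-- The Domino matrix. -/
def domino : Matrix (Fin 3) (Fin 3) ℕ := !![1, 1, 0; 1, 1, 1; 0, 1, 1]

/-! The three infima above are attained minima. -/

theorem partitions_nonempty (A : Matrix m n ℕ) : (partitions A).Nonempty := by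
  classical
  refine ⟨fun B => if B.1.1.card = 1 ∧ B.1.2.card = 1 then 1 else 0, ?_, ?_⟩
  · intro B
    by_cases h : B.1.1.card = 1 ∧ B.1.2.card = 1 <;> simp [h]
  · ext ⟨⟨i, j⟩, h⟩
    let B₀ : Biclique A := ⟨({i}, {j}), by simp, by simp, by simpa using h⟩
    simp only [Matrix.mulVec, dotProduct, incidence, Pi.one_apply]
    rw [Finset.sum_eq_single B₀]
    · simp [B₀, Covers]
    · rintro ⟨⟨S, T⟩, hB⟩ _ hne
      by_cases hc : S.card = 1 ∧ T.card = 1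
      · obtain ⟨hS, hT⟩ := hc
        obtain ⟨a, rfl⟩ := Finset.card_eq_one.1 hS
        obtain ⟨b, rfl⟩ := Finset.card_eq_one.1 hT
        have : ¬ (i = a ∧ j = b) := by
          rintro ⟨rfl, rfl⟩
          exact hne rfl
        simp [Covers, this]
      · simp [hc]
    · simp

theorem partitions_subset (A : Matrix m n ℕ) : partitions A ⊆ fracPartitions A := by
  rintro x ⟨hx, h⟩
  refine ⟨fun B => ?_, h⟩
  rcases hx B with h | h <;> simp [h]

theorem fracPartitions_subset (A : Matrix m n ℕ) : fracPartitions A ⊆ fracCovers A :=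
  fun _ ⟨hx, h⟩ => ⟨hx, h.ge⟩

theorem continuous_weight (A : Matrix m n ℕ) :
    Continuous (weight : (Biclique A → ℝ) → ℝ) := by
  unfold weight
  fun_prop

theorem isLeast_sInf_weight {A : Matrix m n ℕ} {S : Set (Biclique A → ℝ)}
    (hc : IsClosed S) (hne : S.Nonempty) (h0 : ∀ x ∈ S, 0 ≤ x) :
    IsLeast (weight '' S) (sInf (weight '' S)) := by
  obtain ⟨x₀, hx₀⟩ := hne
  have hK : IsCompact (S ∩ {x | weight x ≤ weight x₀}) := by
    refine (isCompact_Icc (a := (0 : Biclique A → ℝ)) (b := fun _ => weight x₀)).of_isClosed_subset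
      (hc.inter (isClosed_le (continuous_weight A) continuous_const)) ?_
    rintro x ⟨hx, hle⟩
    refine ⟨h0 x hx, fun B => le_trans ?_ hle⟩
    exact Finset.single_le_sum (f := x) (fun B _ => h0 x hx B) (Finset.mem_univ B)
  obtain ⟨x, ⟨hxS, hxle⟩, hmin⟩ :=
    hK.exists_isMinOn ⟨x₀, hx₀, le_refl (weight x₀)⟩ (continuous_weight A).continuousOn
  have hl : IsLeast (weight '' S) (weight x) := by
    refine ⟨⟨x, hxS, rfl⟩, ?_⟩
    rintro _ ⟨y, hy, rfl⟩
    by_cases h : weight y ≤ weight x₀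
    · exact hmin ⟨hy, h⟩
    · exact le_trans hxle (le_of_not_ge h)
  rwa [hl.csInf_eq]

theorem continuous_mulVec_incidence (A : Matrix m n ℕ) :
    Continuous fun x : Biclique A → ℝ => incidence A *ᵥ x :=
  continuous_const.matrix_mulVec continuous_id

theorem bpF_isLeast (A : Matrix m n ℕ) : IsLeast (weight '' fracPartitions A) (bpF A) :=
  isLeast_sInf_weight
    ((isClosed_le continuous_const continuous_id).inter
      (isClosed_eq (continuous_mulVec_incidence A) continuous_const))
    ((partitions_nonempty A).mono (partitions_subset A)) (fun _ h => h.1)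

theorem bcF_isLeast (A : Matrix m n ℕ) : IsLeast (weight '' fracCovers A) (bcF A) :=
  isLeast_sInf_weight
    ((isClosed_le continuous_const continuous_id).inter
      (isClosed_le continuous_const (continuous_mulVec_incidence A)))
    (((partitions_nonempty A).mono (partitions_subset A)).mono (fracPartitions_subset A))
    (fun _ h => h.1)

theorem bp_isLeast (A : Matrix m n ℕ) : IsLeast (weight '' partitions A) (bp A) := by
  refine isLeast_sInf_weight (IsClosed.inter ?_ (isClosed_eq (continuous_mulVec_incidence A)
    continuous_const)) (partitions_nonempty A) (fun x h => (partitions_subset A h).1)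
  have : {x : Biclique A → ℝ | ∀ B, x B = 0 ∨ x B = 1} =
      ⋂ B, ({x | x B = 0} ∪ {x | x B = 1}) := by
    ext x; simp
  change IsClosed {x : Biclique A → ℝ | ∀ B, x B = 0 ∨ x B = 1}
  rw [this]
  exact isClosed_iInter fun B =>
    (isClosed_eq (continuous_apply B) continuous_const).union
      (isClosed_eq (continuous_apply B) continuous_const)

end BinMat

/-! Linear programming duality gives the lower bounds. The dual of fractional covering asks for
nonnegative weights on the ones with total at most 1 on every biclique (`IsFracIsolated`); the
indicator of an isolated set is such a weighting, hence `i ≤ bc_f`. The projections of a biclique of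
`A^{⊗k}` to the coordinates are bicliques of `A`, so the tensor power of a dual optimum is again
feasible. With strong duality (`exists_isFracIsolated`) this gives `bc_f(A)^k ≤ bc_f(A^{⊗k}) ≤
bp_f(A^{⊗k})`.

Products of bicliques make `bp_f` submultiplicative (`bpF_le_mul`), so by Fekete's lemma the limit
exists and is the infimum of the `k`-th roots over `k ≥ 1`. Any single power therefore bounds it
from above.

For the Domino matrix the lower bound 2 comes from two opposite corners, the upper bound from an
explicit solution for the fifth power. Coverage need only average to 1 over each orbit of ones under
permutation of the five coordinates and reversal in each of them, since averaging over this group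
then yields a fractional partition (`bpF_le_of_average`). An orbit is named by an exponent, and all
orbit conditions are the base `2^60` digits of one identity between natural numbers
(`bpF_kronPow_domino_le`), which is checked by evaluation. -/

namespace BinMat

/-! ### Fractional partitions and covers, products, and linear programming duality -/

section General

variable {m n : Type*} [Fintype m] [Fintype n]

open Classical in
theorem incidence_mulVec_apply (A : Matrix m n ℕ) (x : Biclique A → ℝ) (e : Edge A) :
    (incidence A *ᵥ x) e = ∑ B, if Covers B e.1 then x B else 0 := by
  simp [Matrix.mulVec, dotProduct, incidence, ite_mul]

/-- Pushforward of weights along `b`, which need not be injective: several members of a family may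
be the same biclique. -/
theorem sum_ite_sum_fiber {ι κ : Type*} [Fintype ι] [Fintype κ] [DecidableEq κ] (b : ι → κ)
    (w : ι → ℝ) (p : κ → Prop) [DecidablePred p] :
    ∑ B, (if p B then ∑ i, (if b i = B then w i else 0) else 0) =
      ∑ i, if p (b i) then w i else 0 := by
  have h : ∀ B, (if p B then ∑ i, (if b i = B then w i else 0) else 0) =
      ∑ i, if b i = B then (if p (b i) then w i else 0) else 0 := by
    intro B
    split_ifs with hB
    · refine Finset.sum_congr rfl fun i _ => ?_
      split_ifs with h₁ h₂
      · rfl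
      · exact (h₂ (h₁ ▸ hB)).elim
      · rfl
    · refine (Finset.sum_eq_zero fun i _ => ?_).symm
      split_ifs with h₁ h₂
      · exact (hB (h₁ ▸ h₂)).elim
      · rfl
      · rfl
  rw [Finset.sum_congr rfl fun B _ => h B, Finset.sum_comm]
  simp

open Classical in
/-- Any nonnegative weighting of a finite family of bicliques that covers each edge with total
weight one bounds the fractional partition number. -/
theorem bpF_le_of_family {A : Matrix m n ℕ} {ι : Type*} [Fintype ι] (b : ι → Biclique A)
    (w : ι → ℝ) (hw : ∀ i, 0 ≤ w i)
    (h : ∀ e : Edge A, ∑ i, (if Covers (b i) e.1 then w i else 0) = 1) :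
    bpF A ≤ ∑ i, w i := by
  refine (bpF_isLeast A).2 ⟨fun B => ∑ i, if b i = B then w i else 0, ⟨?_, ?_⟩, ?_⟩
  · exact fun B => Finset.sum_nonneg fun i _ => by split_ifs <;> simp [hw i]
  · ext e
    rw [incidence_mulVec_apply, Pi.one_apply, ← h e]
    exact sum_ite_sum_fiber b w fun B => Covers B e.1
  · rw [weight, Finset.sum_comm]
    simp

open Classical in
theorem exists_optimal_fracPartition (A : Matrix m n ℕ) :
    ∃ x : Biclique A → ℝ, (∀ B, 0 ≤ x B) ∧
      (∀ e : Edge A, ∑ B, (if Covers B e.1 then x B else 0) = 1) ∧ ∑ B, x B = bpF A := by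
  obtain ⟨x, ⟨hx, h⟩, hw⟩ := (bpF_isLeast A).1
  refine ⟨x, hx, fun e => ?_, hw⟩
  rw [← incidence_mulVec_apply, h, Pi.one_apply]

theorem bpF_nonneg (A : Matrix m n ℕ) : 0 ≤ bpF A := by
  obtain ⟨x, hx, -, h⟩ := exists_optimal_fracPartition A
  rw [← h]
  exact Finset.sum_nonneg fun B _ => hx B

theorem bpF_le_bp (A : Matrix m n ℕ) : bpF A ≤ bp A :=
  (bpF_isLeast A).2 (Set.image_mono (partitions_subset A) (bp_isLeast A).1)

theorem bcF_le_bpF (A : Matrix m n ℕ) : bcF A ≤ bpF A :=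
  (bcF_isLeast A).2 (Set.image_mono (fracPartitions_subset A) (bpF_isLeast A).1)

theorem bpF_eq_zero {A : Matrix m n ℕ} (h : ∀ i j, A i j ≠ 1) : bpF A = 0 := by
  refine le_antisymm ?_ (bpF_nonneg A)
  simpa using bpF_le_of_family (A := A) (ι := Empty) (fun i => i.elim) (fun i => i.elim)
    (fun i => i.elim) (fun e => (h _ _ e.2).elim)

/-- Bicliques pull back along repetition of rows and columns; surjectivity keeps the preimages
nonempty. This serves to identify `A^{⊗1}` with `A`. -/
theorem bpF_le_of_surjective {m' n' : Type*} [Fintype m'] [Fintype n'] {A : Matrix m n ℕ}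
    {A' : Matrix m' n' ℕ} {r : m → m'} {c : n → n'} (hr : r.Surjective) (hc : c.Surjective)
    (h : ∀ i j, A i j = A' (r i) (c j)) : bpF A ≤ bpF A' := by
  classical
  obtain ⟨x, hx, hcov, hsum⟩ := exists_optimal_fracPartition A'
  rw [← hsum]
  refine bpF_le_of_family (fun B => ⟨(Finset.univ.filter (r · ∈ B.1.1),
    Finset.univ.filter (c · ∈ B.1.2)), ?_, ?_, ?_⟩) x hx fun e => ?_
  · obtain ⟨a, ha⟩ := B.2.1
    obtain ⟨i, rfl⟩ := hr a
    exact ⟨i, by simpa using ha⟩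
  · obtain ⟨a, ha⟩ := B.2.2.1
    obtain ⟨i, rfl⟩ := hc a
    exact ⟨i, by simpa using ha⟩
  · intro i hi j hj
    rw [h]
    exact B.2.2.2 _ (by simpa using hi) _ (by simpa using hj)
  · rw [← hcov ⟨(r e.1.1, c e.1.2), by rw [← h]; exact e.2⟩]
    exact Finset.sum_congr rfl fun B _ => if_congr (by simp [Covers]) rfl rfl

/-- Products of bicliques, weighted by products of weights, cover an edge with the product of the
two coverages, which is 1. The equivalences absorb the splitting of a tuple into two blocks. -/
theorem bpF_le_mul {m₁ n₁ m₂ n₂ : Type*} [Fintype m₁] [Fintype n₁] [Fintype m₂] [Fintype n₂]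
    {A : Matrix m n ℕ} {A₁ : Matrix m₁ n₁ ℕ} {A₂ : Matrix m₂ n₂ ℕ}
    (r : m ≃ m₁ × m₂) (c : n ≃ n₁ × n₂)
    (h : ∀ i j, A i j = A₁ (r i).1 (c j).1 * A₂ (r i).2 (c j).2) :
    bpF A ≤ bpF A₁ * bpF A₂ := by
  classical
  obtain ⟨x, hx, hcov, hsum⟩ := exists_optimal_fracPartition A₁
  obtain ⟨y, hy, hcov', hsum'⟩ := exists_optimal_fracPartition A₂
  rw [← hsum, ← hsum', Finset.sum_mul_sum, ← Fintype.sum_prod_type']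
  refine bpF_le_of_family (fun B : Biclique A₁ × Biclique A₂ =>
    ⟨((B.1.1.1 ×ˢ B.2.1.1).map r.symm.toEmbedding, (B.1.1.2 ×ˢ B.2.1.2).map c.symm.toEmbedding),
      ?_, ?_, ?_⟩) (fun B => x B.1 * y B.2) (fun B => mul_nonneg (hx _) (hy _)) fun e => ?_
  · exact (B.1.2.1.product B.2.2.1).map
  · exact (B.1.2.2.1.product B.2.2.2.1).map
  · intro i hi j hj
    simp only [Finset.mem_map_equiv, Equiv.symm_symm, Finset.mem_product] at hi hj
    rw [h, B.1.2.2.2 _ hi.1 _ hj.1, B.2.2.2.2 _ hi.2 _ hj.2]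
  · have he := e.2
    rw [h, mul_eq_one] at he
    have h1 := hcov ⟨((r e.1.1).1, (c e.1.2).1), he.1⟩
    have h2 := hcov' ⟨((r e.1.1).2, (c e.1.2).2), he.2⟩
    have h3 := congrArg₂ (· * ·) h1 h2
    simp only [Finset.sum_mul_sum, mul_one] at h3
    rw [Fintype.sum_prod_type]
    refine Eq.trans ?_ h3
    refine Finset.sum_congr rfl fun B _ => Finset.sum_congr rfl fun B' _ => ?_
    rw [ite_zero_mul_ite_zero]
    refine if_congr ?_ rfl rfl
    simp only [Covers, Finset.mem_map_equiv, Equiv.symm_symm, Finset.mem_product]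
    tauto

/-- A feasible solution of the linear program dual to fractional biclique covering, extended by
zero off the ones of `A`. -/
structure IsFracIsolated (A : Matrix m n ℕ) (y : m → n → ℝ) : Prop where
  nonneg : ∀ i j, 0 ≤ y i j
  supp : ∀ i j, A i j ≠ 1 → y i j = 0
  sum_le : ∀ B : Biclique A, ∑ i ∈ B.1.1, ∑ j ∈ B.1.2, y i j ≤ 1

open Classical in
theorem exists_optimal_fracCover (A : Matrix m n ℕ) :
    ∃ x : Biclique A → ℝ, (∀ B, 0 ≤ x B) ∧
      (∀ e : Edge A, 1 ≤ ∑ B, (if Covers B e.1 then x B else 0)) ∧ ∑ B, x B = bcF A := by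
  obtain ⟨x, ⟨hx, h⟩, hw⟩ := (bcF_isLeast A).1
  refine ⟨x, hx, fun e => ?_, hw⟩
  rw [← incidence_mulVec_apply]
  exact h e

open Classical in
theorem sum_biclique_eq (A : Matrix m n ℕ) (B : Biclique A) (y : m → n → ℝ) :
    ∑ i ∈ B.1.1, ∑ j ∈ B.1.2, y i j = ∑ i, ∑ j, if Covers B (i, j) then y i j else 0 := by
  have h : ∀ (S : Finset m) (T : Finset n),
      ∑ i ∈ S, ∑ j ∈ T, y i j = ∑ i, ∑ j, if i ∈ S ∧ j ∈ T then y i j else 0 := by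
    intro S T
    simp [ite_and, Finset.sum_ite_mem]
  rw [h]
  exact Finset.sum_congr rfl fun i _ => Finset.sum_congr rfl fun j _ => if_congr Iff.rfl rfl rfl

/-- Weak duality: count `∑ x B * y e` over incident pairs in both orders. -/
theorem IsFracIsolated.sum_le_bcF {A : Matrix m n ℕ} {y : m → n → ℝ} (h : IsFracIsolated A y) :
    ∑ i, ∑ j, y i j ≤ bcF A := by
  classical
  obtain ⟨x, hx, hcov, hsum⟩ := exists_optimal_fracCover A
  have h1 : ∀ i j, y i j ≤ ∑ B : Biclique A, x B * (if Covers B (i, j) then y i j else 0) := by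
    intro i j
    by_cases hA : A i j = 1
    · have := mul_le_mul_of_nonneg_right (hcov ⟨(i, j), hA⟩) (h.nonneg i j)
      simpa [Finset.sum_mul] using this
    · simp [h.supp i j hA]
  calc ∑ i, ∑ j, y i j
      ≤ ∑ i, ∑ j, ∑ B : Biclique A, x B * (if Covers B (i, j) then y i j else 0) :=
        Finset.sum_le_sum fun i _ => Finset.sum_le_sum fun j _ => h1 i j
    _ = ∑ B : Biclique A, x B * ∑ i ∈ B.1.1, ∑ j ∈ B.1.2, y i j := by
        simp_rw [sum_biclique_eq, Finset.mul_sum]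
        exact (Finset.sum_congr rfl fun i _ => Finset.sum_comm).trans Finset.sum_comm
    _ ≤ ∑ B : Biclique A, x B :=
        Finset.sum_le_sum fun B _ => mul_le_of_le_one_right (hx B) (h.sum_le B)
    _ = bcF A := hsum

theorem isoNum_le_bcF (A : Matrix m n ℕ) : (isoNum A : ℝ) ≤ bcF A := by
  classical
  have key : ∀ F, IsIsolated A F → (F.card : ℝ) ≤ bcF A := by
    intro F hF
    have hy : IsFracIsolated A fun i j => if (i, j) ∈ F then 1 else 0 := by
      refine ⟨fun i j => by split_ifs <;> simp, fun i j hA => if_neg fun hm => hA (hF.1 _ hm),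
        fun B => ?_⟩
      rw [← Finset.sum_product', Finset.sum_boole]
      have : (Finset.filter (fun x : m × n => (x.1, x.2) ∈ F) (B.1.1 ×ˢ B.1.2)).card ≤ 1 := by
        refine Finset.card_le_one.2 fun e he f hf => ?_
        by_contra hne
        simp only [Finset.mem_filter, Finset.mem_product] at he hf
        exact hF.2 e he.2 f hf.2 hne ⟨B, he.1, hf.1⟩
      exact_mod_cast this
    refine le_trans (le_of_eq ?_) hy.sum_le_bcF
    rw [← Fintype.sum_prod_type']
    simp
  obtain ⟨F, hF, hc⟩ := Finset.exists_mem_eq_sup (Finset.univ.filter (IsIsolated A))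
    ⟨∅, by simp [IsIsolated]⟩ Finset.card
  rw [isoNum, hc]
  exact key F (Finset.mem_filter.1 hF).2

theorem one_le_bcF {A : Matrix m n ℕ} {i : m} {j : n} (h : A i j = 1) : 1 ≤ bcF A := by
  classical
  refine le_trans ?_ (isoNum_le_bcF A)
  have : ({(i, j)} : Finset (m × n)).card ≤ isoNum A :=
    Finset.le_sup (f := Finset.card) (by simp [IsIsolated, h])
  exact_mod_cast this

theorem sum_extend_edge (A : Matrix m n ℕ) {y : m → n → ℝ} (h : ∀ i j, A i j ≠ 1 → y i j = 0) :
    ∑ i, ∑ j, y i j = ∑ e : Edge A, y e.1.1 e.1.2 := by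
  classical
  rw [← Fintype.sum_prod_type' y,
    ← Finset.sum_subtype (Finset.univ.filter fun e : m × n => A e.1 e.2 = 1) (by simp)
      (fun e : m × n => y e.1 e.2), Finset.sum_filter]
  refine Finset.sum_congr rfl fun e _ => ?_
  split_ifs with he
  · rfl
  · exact h _ _ he

/-- Strong duality for fractional biclique covers. -/
theorem exists_isFracIsolated (A : Matrix m n ℕ) :
    ∃ y, IsFracIsolated A y ∧ ∑ i, ∑ j, y i j = bcF A := by
  classical
  by_cases hE : ∀ i j, A i j ≠ 1
  · have h0 : IsFracIsolated A fun _ _ => 0 := ⟨by simp, by simp, by simp⟩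
    refine ⟨_, h0, le_antisymm h0.sum_le_bcF ?_⟩
    simpa [bpF_eq_zero hE] using bcF_le_bpF A
  push Not at hE
  obtain ⟨i₀, j₀, h₀⟩ := hE
  have : Nonempty (Edge A) := ⟨⟨(i₀, j₀), h₀⟩⟩
  set v := bcF A with hv
  have hv1 : 1 ≤ v := one_le_bcF h₀
  have hv0 : 0 < v := one_pos.trans_le hv1
  -- A point of `K` in `Q` would be a probability vector covering every edge by more than `1 / v`;
  -- divided by its least coverage it becomes a cover of weight below `v`. So `Q` and `K` can be
  -- separated, and the separating functional, rescaled, is the dual optimum.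
  let Q : Set (Edge A → ℝ) := Set.pi Set.univ fun _ => Set.Ioi (1 / v)
  let K : Set (Edge A → ℝ) := (incidence A).mulVecLin '' stdSimplex ℝ (Biclique A)
  have hdisj : Disjoint Q K := by
    rw [Set.disjoint_left]
    rintro _ hQ ⟨x, ⟨hx, hx1⟩, rfl⟩
    obtain ⟨e, he⟩ := Finite.exists_min fun e => (incidence A *ᵥ x) e
    have hμ : 1 / v < (incidence A *ᵥ x) e := hQ e trivial
    set μ := (incidence A *ᵥ x) e
    have hμ0 : 0 < μ := lt_trans (by positivity) hμ
    have hle : v ≤ weight (μ⁻¹ • x) := by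
      refine (bcF_isLeast A).2 ⟨μ⁻¹ • x,
        ⟨fun B => mul_nonneg (by positivity) (hx B), fun e' => ?_⟩, rfl⟩
      rw [Matrix.mulVec_smul, Pi.smul_apply, Pi.one_apply, smul_eq_mul, inv_mul_eq_div,
        one_le_div hμ0]
      exact he e'
    have hw : weight (μ⁻¹ • x) = μ⁻¹ := by
      simp only [weight, Pi.smul_apply, smul_eq_mul, ← Finset.mul_sum]
      rw [hx1, mul_one]
    rw [hw] at hle
    rw [one_div, inv_lt_comm₀ hv0 hμ0] at hμ
    linarith
  obtain ⟨f, u, hfQ, hfK⟩ := geometric_hahn_banach_open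
    (convex_pi fun _ _ => convex_Ioi _) (isOpen_set_pi Set.finite_univ fun _ _ => isOpen_Ioi)
    ((convex_stdSimplex ℝ _).linear_image _) hdisj
  let c : Edge A → ℝ := fun e => -f (Pi.single e 1)
  have hf : ∀ z, f z = -∑ e, z e * c e := by
    intro z
    conv_lhs => rw [← Finset.univ_sum_single z, map_sum]
    rw [← Finset.sum_neg_distrib]
    refine Finset.sum_congr rfl fun e _ => ?_
    have : (Pi.single e (z e) : Edge A → ℝ) = z e • Pi.single e 1 := by
      rw [← Pi.single_smul]; simp
    rw [this, map_smul]
    simp [c]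
  have hQ : ∀ z : Edge A → ℝ, (∀ e, 1 / v < z e) → -u < ∑ e, z e * c e := by
    intro z hz
    have := hfQ z fun e _ => hz e
    rw [hf] at this
    linarith
  have hK : ∀ B : Biclique A, ∑ e : Edge A, (if Covers B e.1 then c e else 0) ≤ -u := by
    intro B
    have := hfK _ ⟨_, single_mem_stdSimplex ℝ B, rfl⟩
    rw [hf] at this
    have h2 : ∀ e, (incidence A).mulVecLin (Pi.single B 1) e * c e =
        if Covers B e.1 then c e else 0 := by
      intro e
      rw [Matrix.mulVecLin_apply, Matrix.mulVec_single_one]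
      simp [incidence, Matrix.col]
    rw [Finset.sum_congr rfl fun e _ => h2 e] at this
    linarith
  set C := ∑ e, c e with hC
  have hconst : ∀ t, 1 / v < t → -u < t * C := by
    intro t ht
    rw [hC, Finset.mul_sum]
    exact hQ _ fun _ => ht
  have hc : ∀ e, 0 ≤ c e := by
    intro e
    by_contra! hneg
    have h1 := hconst (2 / v) (by gcongr; norm_num)
    -- If `c e < 0`, raising coordinate `e` of the constant point `2 / v` by this amount brings the
    -- functional down to exactly `-u`, while the point stays in `Q`.
    have ht : 0 < (2 / v * C + u) / (-c e) := div_pos (by linarith) (by linarith)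
    have h2 := hQ (fun e' => 2 / v + Pi.single (M := fun _ => ℝ) e ((2 / v * C + u) / (-c e)) e')
      fun e' => by
        have : 1 / v < 2 / v := by gcongr; norm_num
        have h3 : 0 ≤ Pi.single (M := fun _ => ℝ) e ((2 / v * C + u) / (-c e)) e' := by
          by_cases h : e' = e
          · subst h; simpa using ht.le
          · simp [h]
        linarith
    simp only [add_mul, Finset.sum_add_distrib, ← Finset.mul_sum, ← hC] at h2
    rw [Finset.sum_eq_single e (fun e' _ h => by simp [h]) (by simp), Pi.single_eq_same] at h2
    have : (2 / v * C + u) / (-c e) * c e = -(2 / v * C + u) := by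
      rw [div_mul_eq_mul_div, div_neg, mul_div_cancel_right₀ _ hneg.ne]
    linarith
  have hCpos : 0 < C := by
    refine lt_of_le_of_ne (Finset.sum_nonneg fun e _ => hc e) fun h => ?_
    have h1 := hconst (2 / v) (by gcongr; norm_num)
    have h2 := hK ⟨({i₀}, {j₀}), by simp, by simp, by simpa using h₀⟩
    have h3 : 0 ≤ ∑ e : Edge A, (if Covers (A := A)
      ⟨({i₀}, {j₀}), by simp, by simp, by simpa using h₀⟩ e.1 then c e else 0) :=
      Finset.sum_nonneg fun e _ => by split_ifs <;> simp [hc e]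
    rw [← h] at h1
    linarith
  -- The corner `1 / v` is only a limit of points of `Q`; if the bound failed, the constant point
  -- `-u / C` would lie in `Q` and have value `-u`.
  have hu : -u ≤ C / v := by
    by_contra! hlt
    have := hconst (-u / C) (by rw [div_lt_div_iff₀ hv0 hCpos]; rw [div_lt_iff₀ hv0] at hlt; linarith)
    rw [div_mul_cancel₀ _ hCpos.ne'] at this
    exact lt_irrefl _ this
  let y : m → n → ℝ := fun i j => if h : A i j = 1 then v / C * c ⟨(i, j), h⟩ else 0
  have hy : ∀ i j, A i j ≠ 1 → y i j = 0 := fun i j h => dif_neg h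
  have hy' : ∀ e : Edge A, y e.1.1 e.1.2 = v / C * c e := fun e => dif_pos e.2
  refine ⟨y, ⟨fun i j => ?_, hy, fun B => ?_⟩, ?_⟩
  · by_cases h : A i j = 1
    · rw [hy' ⟨(i, j), h⟩]
      exact mul_nonneg (by positivity) (hc _)
    · rw [hy i j h]
  · rw [sum_biclique_eq, sum_extend_edge A fun i j h => by rw [hy i j h, ite_self]]
    calc ∑ e : Edge A, (if Covers B (e.1.1, e.1.2) then y e.1.1 e.1.2 else 0)
        = v / C * ∑ e : Edge A, (if Covers B e.1 then c e else 0) := by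
          rw [Finset.mul_sum]
          refine Finset.sum_congr rfl fun e _ => ?_
          rw [hy', mul_ite, mul_zero]
      _ ≤ v / C * (C / v) := by
          gcongr
          exact (hK B).trans hu
      _ = 1 := by field_simp
  · rw [sum_extend_edge A hy, Finset.sum_congr rfl fun e _ => hy' e, ← Finset.mul_sum, ← hC]
    field_simp

end General

/-! ### Kronecker powers and the asymptotic rank -/

section Asymptotic

variable {m n : Type*} [Fintype m] [Fintype n]

/-- A biclique of the power lies in the box of its coordinate projections. Each projection is a
biclique of `A`, because a product of natural numbers is 1 only if every factor is, and the sum over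
the box factors. -/
theorem IsFracIsolated.kronPow {A : Matrix m n ℕ} {y : m → n → ℝ} (h : IsFracIsolated A y)
    (k : ℕ) : IsFracIsolated (kronPow A k) fun i j => ∏ t, y (i t) (j t) := by
  classical
  refine ⟨fun i j => Finset.prod_nonneg fun t _ => h.nonneg _ _, fun i j hA => ?_, fun B => ?_⟩
  · obtain ⟨t, ht⟩ : ∃ t, A (i t) (j t) ≠ 1 := by
      by_contra! hall
      exact hA (Finset.prod_eq_one fun t _ => hall t)
    exact Finset.prod_eq_zero (Finset.mem_univ t) (h.supp _ _ ht)
  · let C : Fin k → Biclique A := fun t =>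
      ⟨(B.1.1.image (· t), B.1.2.image (· t)), B.2.1.image _, B.2.2.1.image _, by
        intro a ha b hb
        obtain ⟨i, hi, rfl⟩ := Finset.mem_image.1 ha
        obtain ⟨j, hj, rfl⟩ := Finset.mem_image.1 hb
        exact Finset.prod_eq_one_iff.1 (B.2.2.2 i hi j hj) t (Finset.mem_univ t)⟩
    calc ∑ i ∈ B.1.1, ∑ j ∈ B.1.2, ∏ t, y (i t) (j t)
        ≤ ∑ i ∈ Fintype.piFinset fun t => (C t).1.1, ∑ j ∈ Fintype.piFinset fun t => (C t).1.2,
            ∏ t, y (i t) (j t) := by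
          have hnn : ∀ (i : Fin k → m) (j : Fin k → n), 0 ≤ ∏ t, y (i t) (j t) := fun i j =>
            Finset.prod_nonneg fun t _ => h.nonneg _ _
          refine (Finset.sum_le_sum fun i _ => Finset.sum_le_sum_of_subset_of_nonneg ?_
            fun j _ _ => hnn i j).trans (Finset.sum_le_sum_of_subset_of_nonneg ?_
            fun i _ _ => Finset.sum_nonneg fun j _ => hnn i j)
          · exact fun j hj => Fintype.mem_piFinset.2 fun t => Finset.mem_image_of_mem _ hj
          · exact fun i hi => Fintype.mem_piFinset.2 fun t => Finset.mem_image_of_mem _ hi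
      _ = ∏ t, ∑ a ∈ (C t).1.1, ∑ b ∈ (C t).1.2, y a b := by
          rw [Finset.prod_univ_sum]
          exact Finset.sum_congr rfl fun i _ => (Finset.prod_univ_sum _ _).symm
      _ ≤ 1 := Finset.prod_le_one (fun t _ => Finset.sum_nonneg fun a _ =>
          Finset.sum_nonneg fun b _ => h.nonneg a b) fun t _ => h.sum_le (C t)

theorem bcF_pow_le_bcF_kronPow (A : Matrix m n ℕ) (k : ℕ) : bcF A ^ k ≤ bcF (kronPow A k) := by
  classical
  obtain ⟨y, hy, hsum⟩ := exists_isFracIsolated A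
  refine le_trans (le_of_eq ?_) (hy.kronPow k).sum_le_bcF
  rw [← hsum, ← Fin.prod_const, Finset.prod_univ_sum, Fintype.piFinset_univ]
  refine Finset.sum_congr rfl fun i _ => ?_
  rw [Finset.prod_univ_sum, Fintype.piFinset_univ]

theorem bpF_kronPow_add_le (A : Matrix m n ℕ) (k l : ℕ) :
    bpF (kronPow A (k + l)) ≤ bpF (kronPow A k) * bpF (kronPow A l) := by
  refine bpF_le_mul (Fin.appendEquiv k l).symm (Fin.appendEquiv k l).symm fun i j => ?_
  rw [kronPow, Fin.prod_univ_add]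
  rfl

theorem bpF_kronPow_one_le (A : Matrix m n ℕ) : bpF (kronPow A 1) ≤ bpF A :=
  bpF_le_of_surjective (r := fun i => i 0) (c := fun j => j 0)
    (fun a => ⟨fun _ => a, rfl⟩) (fun a => ⟨fun _ => a, rfl⟩)
    fun i j => by simp [kronPow]

theorem exists_tendsto_bpF_kronPow_rpow (A : Matrix m n ℕ) :
    ∃ L : ℝ, Tendsto (fun k : ℕ => bpF (kronPow A k) ^ (1 / (k : ℝ))) atTop (𝓝 L) ∧
      ∀ k : ℕ, k ≠ 0 → L ≤ bpF (kronPow A k) ^ (1 / (k : ℝ)) := by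
  by_cases hA : ∀ i j, A i j ≠ 1
  -- At `k = 0` the exponent `1 / 0` is 0 and the term is 1, which does not affect the limit.
  · have h0 : ∀ k : ℕ, k ≠ 0 → bpF (kronPow A k) ^ (1 / (k : ℝ)) = 0 := by
      intro k hk
      rw [bpF_eq_zero, Real.zero_rpow (by positivity)]
      intro i j h
      exact hA _ _ (Finset.prod_eq_one_iff.1 h ⟨0, Nat.pos_of_ne_zero hk⟩ (Finset.mem_univ _))
    refine ⟨0, tendsto_const_nhds.congr' ?_, fun k hk => (h0 k hk).ge⟩
    filter_upwards [eventually_ne_atTop 0] with k hk using (h0 k hk).symm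
  push Not at hA
  obtain ⟨i₀, j₀, h₀⟩ := hA
  -- A one in `A` gives a one in every power, so the logarithms are nonnegative and Fekete's lemma
  -- applies.
  have h1 : ∀ k, 1 ≤ bpF (kronPow A k) := fun k =>
    (one_le_bcF (i := fun _ => i₀) (j := fun _ => j₀)
      (Finset.prod_eq_one fun _ _ => h₀)).trans (bcF_le_bpF _)
  have hpos : ∀ k, 0 < bpF (kronPow A k) := fun k => one_pos.trans_le (h1 k)
  have hsub : Subadditive fun k => Real.log (bpF (kronPow A k)) := fun k l => by
    rw [← Real.log_mul (hpos k).ne' (hpos l).ne']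
    exact Real.log_le_log (hpos _) (bpF_kronPow_add_le A k l)
  have hbdd : BddBelow (Set.range fun k : ℕ => Real.log (bpF (kronPow A k)) / k) :=
    ⟨0, by rintro _ ⟨k, rfl⟩; exact div_nonneg (Real.log_nonneg (h1 k)) k.cast_nonneg⟩
  have hexp : ∀ k : ℕ, bpF (kronPow A k) ^ (1 / (k : ℝ)) =
      Real.exp (Real.log (bpF (kronPow A k)) / k) := fun k => by
    rw [Real.rpow_def_of_pos (hpos k), mul_one_div]
  refine ⟨Real.exp hsub.lim, ?_, fun k hk => ?_⟩
  · simp_rw [hexp]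
    exact (Real.continuous_exp.tendsto _).comp (hsub.tendsto_lim hbdd)
  · rw [hexp]
    exact Real.exp_le_exp.2 (hsub.lim_le_div hbdd hk)

theorem tendsto_bpFInf (A : Matrix m n ℕ) :
    Tendsto (fun k : ℕ => bpF (kronPow A k) ^ (1 / (k : ℝ))) atTop (𝓝 (bpFInf A)) := by
  obtain ⟨L, hL, -⟩ := exists_tendsto_bpF_kronPow_rpow A
  rwa [bpFInf, hL.limUnder_eq]

theorem bpFInf_le_rpow (A : Matrix m n ℕ) {k : ℕ} (hk : k ≠ 0) :
    bpFInf A ≤ bpF (kronPow A k) ^ (1 / (k : ℝ)) := by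
  obtain ⟨L, hL, h⟩ := exists_tendsto_bpF_kronPow_rpow A
  rw [tendsto_nhds_unique (tendsto_bpFInf A) hL]
  exact h k hk

theorem bpFInf_le_bpF (A : Matrix m n ℕ) : bpFInf A ≤ bpF A := by
  simpa using (bpFInf_le_rpow A one_ne_zero).trans
    (by simpa using bpF_kronPow_one_le A : _ ≤ bpF A)

theorem bcF_nonneg (A : Matrix m n ℕ) : 0 ≤ bcF A :=
  (Nat.cast_nonneg _).trans (isoNum_le_bcF A)

theorem bcF_le_bpFInf (A : Matrix m n ℕ) : bcF A ≤ bpFInf A := by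
  refine ge_of_tendsto (tendsto_bpFInf A) ?_
  filter_upwards [eventually_ne_atTop 0] with k hk
  rw [one_div, Real.le_rpow_inv_iff_of_pos (bcF_nonneg A) (bpF_nonneg _) (by positivity),
    Real.rpow_natCast]
  exact (bcF_pow_le_bcF_kronPow A k).trans (bcF_le_bpF _)

end Asymptotic

theorem two_le_isoNum_domino : 2 ≤ isoNum domino := by
  classical
  -- A common all-ones submatrix would contain position `(0, 2)`, which is a zero.
  have h : IsIsolated domino {(0, 0), (2, 2)} := by
    refine ⟨by decide, ?_⟩
    have key : ¬ ∃ B : Biclique domino, Covers B (0, 0) ∧ Covers B (2, 2) := by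
      rintro ⟨B, h0, h2⟩
      exact absurd (B.2.2.2 0 h0.1 2 h2.2) (by decide)
    intro e he f hf hne hB
    simp only [Finset.mem_insert, Finset.mem_singleton] at he hf
    rcases he with rfl | rfl <;> rcases hf with rfl | rfl
    · exact hne rfl
    · exact key hB
    · exact key (by simpa only [and_comm] using hB)
    · exact hne rfl
  exact Finset.le_sup (f := Finset.card) (Finset.mem_filter.2 ⟨Finset.mem_univ _, h⟩)

/-! ### Averaging over automorphisms -/

section Symmetrization

variable {m n : Type*} [Fintype m] [Fintype n]

/-- The pairs of a row and a column permutation that preserve `v`. -/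
def autGroup {γ : Type*} (v : m → n → γ) : Subgroup (Equiv.Perm m × Equiv.Perm n) where
  carrier := {p | ∀ i j, v (p.1 i) (p.2 j) = v i j}
  one_mem' := fun _ _ => rfl
  mul_mem' := fun {p q} hp hq i j => (hp _ _).trans (hq i j)
  inv_mem' := fun {p} hp i j => by
    have := hp (p.1⁻¹ i) (p.2⁻¹ j)
    simpa using this.symm

/-- The preimage of a biclique under an automorphism of the bipartite graph. -/
def Biclique.comap {A : Matrix m n ℕ} (B : Biclique A) (p : Equiv.Perm m × Equiv.Perm n)
    (hp : ∀ i j, A (p.1 i) (p.2 j) = A i j) : Biclique A :=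
  ⟨(B.1.1.map p.1.symm.toEmbedding, B.1.2.map p.2.symm.toEmbedding), B.2.1.map, B.2.2.1.map, by
    intro i hi j hj
    simp only [Finset.mem_map_equiv, Equiv.symm_symm] at hi hj
    rw [← hp]
    exact B.2.2.2 _ hi _ hj⟩

theorem covers_comap {A : Matrix m n ℕ} (B : Biclique A) (p : Equiv.Perm m × Equiv.Perm n)
    (hp : ∀ i j, A (p.1 i) (p.2 j) = A i j) (e : m × n) :
    Covers (B.comap p hp) e ↔ Covers B (p.1 e.1, p.2 e.2) := by
  simp [Covers, Biclique.comap, Finset.mem_map_equiv]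

open Classical in
/-- A weighted family of bicliques whose average coverage over every orbit of edges is one can be
symmetrized to a fractional partition. The orbits are the level sets of `v`. -/
theorem bpF_le_of_average {A : Matrix m n ℕ} {γ : Type*} [DecidableEq γ]
    (v : m → n → γ) (hvA : ∀ i j i' j', v i j = v i' j' → A i j = A i' j')
    (htrans : ∀ i j i' j', A i j = 1 → v i j = v i' j' →
      ∃ p ∈ autGroup v, p.1 i = i' ∧ p.2 j = j')
    {ι : Type*} [Fintype ι] (b : ι → Biclique A) (w : ι → ℝ) (hw : ∀ i, 0 ≤ w i)
    (havg : ∀ i j, A i j = 1 →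
      ∑ e : m × n with v e.1 e.2 = v i j, ∑ c, (if Covers (b c) e then w c else 0) =
        ((Finset.univ.filter fun e : m × n => v e.1 e.2 = v i j).card : ℝ)) :
    bpF A ≤ ∑ c, w c := by
  let G := autGroup v
  have hG : (0 : ℝ) < Fintype.card G := by exact_mod_cast Fintype.card_pos
  have hGA : ∀ (g : G) i j, A (g.1.1 i) (g.1.2 j) = A i j := fun g i j => hvA _ _ _ _ (g.2 i j)
  let F : m × n → ℝ := fun e => ∑ c, (if Covers (b c) e then w c else 0)
  let act : G → m × n → m × n := fun g e => (g.1.1 e.1, g.1.2 e.2)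
  have hF : ∀ e : m × n, A e.1 e.2 = 1 → ∑ g : G, F (act g e) = Fintype.card G := by
    intro e he
    set o := Finset.univ.filter fun e' : m × n => v e'.1 e'.2 = v e.1 e.2 with ho
    -- Averaged coverage is constant on the orbit, by translation in the group, and each
    -- automorphism preserves the total coverage of the orbit. So the averaged coverage equals the
    -- mean, which is 1.
    have hconst : ∀ e' ∈ o, ∑ g : G, F (act g e') = ∑ g : G, F (act g e) := by
      intro e' he'
      obtain ⟨p, hp, h1, h2⟩ := htrans _ _ e'.1 e'.2 he (Finset.mem_filter.1 he').2.symm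
      have : e' = act ⟨p, hp⟩ e := Prod.ext h1.symm h2.symm
      rw [this]
      exact Fintype.sum_equiv (Equiv.mulRight (⟨p, hp⟩ : G)) _ _ fun g => rfl
    have hperm : ∀ g : G, ∑ e' ∈ o, F (act g e') = ∑ e' ∈ o, F e' := by
      intro g
      refine Finset.sum_equiv (Equiv.prodCongr g.1.1 g.1.2) (fun e' => ?_) fun e' _ => rfl
      simp only [ho, Finset.mem_filter, Finset.mem_univ, true_and, Equiv.prodCongr_apply,
        Prod.map_fst, Prod.map_snd]
      rw [g.2]
    have hcard : (0 : ℝ) < o.card :=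
      Nat.cast_pos.2 (Finset.card_pos.2 ⟨e, Finset.mem_filter.2 ⟨Finset.mem_univ _, rfl⟩⟩)
    have h1 : ∑ e' ∈ o, ∑ g : G, F (act g e') = o.card * ∑ g : G, F (act g e) := by
      rw [Finset.sum_congr rfl hconst, Finset.sum_const, nsmul_eq_mul]
    rw [Finset.sum_comm, Finset.sum_congr rfl fun g _ => hperm g, Finset.sum_const, nsmul_eq_mul,
      show ∑ e' ∈ o, F e' = o.card from havg e.1 e.2 he, mul_comm, Finset.card_univ] at h1
    exact (mul_left_cancel₀ hcard.ne' h1).symm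
  have key := bpF_le_of_family (A := A) (ι := G × ι) (fun x => (b x.2).comap x.1.1 (hGA x.1))
    (fun x => w x.2 / Fintype.card G) (fun x => div_nonneg (hw _) hG.le) fun e => by
      rw [Fintype.sum_prod_type]
      have h1 : ∀ g : G, (∑ c, if Covers ((b c).comap g.1 (hGA g)) e.1 then
          w c / (Fintype.card G : ℝ) else 0) = F (act g e.1) / Fintype.card G := by
        intro g
        rw [Finset.sum_div]
        refine Finset.sum_congr rfl fun c _ => ?_
        rw [ite_div, zero_div]
        exact if_congr (covers_comap _ _ _ _) rfl rfl
      rw [Finset.sum_congr rfl fun g _ => h1 g, ← Finset.sum_div, hF _ e.2, div_self hG.ne']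
  refine key.trans (le_of_eq ?_)
  rw [Fintype.sum_prod_type]
  simp only [Finset.sum_const, Finset.card_univ, nsmul_eq_mul, ← Finset.sum_div]
  field_simp

end Symmetrization

/-! ### Reading off base `b` digits -/

section Digits

theorem eq_of_sum_mul_pow_eq {b : ℕ} (M : ℕ) {f g : ℕ → ℕ} (hf : ∀ o, f o < b) (hg : ∀ o, g o < b)
    (h : ∑ o ∈ Finset.range M, f o * b ^ o = ∑ o ∈ Finset.range M, g o * b ^ o) :
    ∀ o < M, f o = g o := by
  have hb : 0 < b := (Nat.zero_le _).trans_lt (hf 0)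
  induction M generalizing f g with
  | zero => simp
  | succ M ih =>
    have hs : ∀ f : ℕ → ℕ, ∑ o ∈ Finset.range (M + 1), f o * b ^ o =
        f 0 + b * ∑ o ∈ Finset.range M, f (o + 1) * b ^ o := fun f => by
      rw [Finset.sum_range_succ', pow_zero, mul_one, add_comm, Finset.mul_sum]
      congr 1
      exact Finset.sum_congr rfl fun o _ => by ring
    rw [hs, hs] at h
    have h0 : f 0 = g 0 := by
      have := congrArg (· % b) h
      simpa [Nat.add_mul_mod_self_left, Nat.mod_eq_of_lt (hf 0), Nat.mod_eq_of_lt (hg 0)] using this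
    have h1 := ih (f := fun o => f (o + 1)) (g := fun o => g (o + 1)) (fun o => hf _)
      (fun o => hg _) (Nat.eq_of_mul_eq_mul_left hb (by omega))
    rintro (_ | o) ho
    · exact h0
    · exact h1 o (by omega)

/-- Equality of two base `b` generating functions with small total mass gives equality of the
masses of all level sets of the exponent. -/
theorem sum_fiber_eq_of_sum_mul_pow_eq {E : Type*} [Fintype E] {b : ℕ} (f g d : E → ℕ)
    (hf : ∑ e, f e < b) (hg : ∑ e, g e < b)
    (h : ∑ e, f e * b ^ d e = ∑ e, g e * b ^ d e) (o : ℕ) :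
    ∑ e with d e = o, f e = ∑ e with d e = o, g e := by
  have hlt : ∀ f : E → ℕ, ∑ e, f e < b → ∀ o, ∑ e with d e = o, f e < b := fun f hf o =>
    (Finset.sum_le_sum_of_subset (Finset.filter_subset _ _)).trans_lt hf
  -- Large enough to exceed every exponent and also `o`, whose level set may be empty.
  set M := Finset.univ.sup d + o + 1
  have hM : ∀ f : E → ℕ, ∑ e, f e * b ^ d e =
      ∑ o ∈ Finset.range M, (∑ e with d e = o, f e) * b ^ o := fun f => by
    rw [← Finset.sum_fiberwise_of_maps_to (s := Finset.univ) (t := Finset.range M) (g := d)]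
    · refine Finset.sum_congr rfl fun o _ => ?_
      rw [Finset.sum_mul]
      exact Finset.sum_congr rfl fun e he => by rw [(Finset.mem_filter.1 he).2]
    · intro e _
      have := Finset.le_sup (f := d) (Finset.mem_univ e)
      exact Finset.mem_range.2 (by omega)
  rw [hM, hM] at h
  exact eq_of_sum_mul_pow_eq M (hlt f hf) (hlt g hg) h o (by omega)

end Digits

/-! ### Orbits and the certificate for the fifth power of the Domino matrix -/

section Domino

theorem kronPow_eq_one_iff {m n : Type*} {A : Matrix m n ℕ} {k : ℕ} {i : Fin k → m}
    {j : Fin k → n} : kronPow A k i j = 1 ↔ ∀ t, A (i t) (j t) = 1 := by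
  simp [kronPow, Finset.prod_eq_one_iff]

theorem domino_apply (a b : Fin 3) :
    domino a b = if a.val + 2 = b.val ∨ b.val + 2 = a.val then 0 else 1 := by
  fin_cases a <;> fin_cases b <;> rfl

theorem isBinary_domino : IsBinary domino := by
  intro i j
  rw [domino_apply]
  split_ifs <;> simp

/-- A label of the positions of the Domino matrix; on the ones, its level sets are the orbits under
reversal of rows and columns. -/
def dominoExp (a b : Fin 3) : ℕ :=
  if a = 1 then (if b = 1 then 36 else 6) else (if b = 1 then 1 else 0)

theorem dominoExp_mem (a b : Fin 3) :
    dominoExp a b = 0 ∨ dominoExp a b = 1 ∨ dominoExp a b = 6 ∨ dominoExp a b = 36 := by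
  revert a b
  decide

/-- The sum of the labels of the coordinates of a position of the fifth power. -/
def powExp (i j : Fin 5 → Fin 3) : ℕ := ∑ t, dominoExp (i t) (j t)

theorem exists_perm_of_dominoExp_eq (a b a' b' : Fin 3) (h : domino a b = 1)
    (h' : domino a' b' = 1) (he : dominoExp a b = dominoExp a' b') :
    ∃ r : Equiv.Perm (Fin 3), r ∈ ({1, Fin.revPerm} : Set (Equiv.Perm (Fin 3))) ∧
      r a = a' ∧ r b = b' := by
  have key : ∀ a b a' b' : Fin 3, domino a b = 1 → domino a' b' = 1 →
      dominoExp a b = dominoExp a' b' → (a = a' ∧ b = b') ∨ (a.rev = a' ∧ b.rev = b') := by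
    simp only [domino_apply]
    decide
  rcases key a b a' b' h h' he with h | h
  · exact ⟨1, by simp, h⟩
  · exact ⟨Fin.revPerm, by simp, h⟩

theorem domino_perm {r : Equiv.Perm (Fin 3)}
    (hr : r ∈ ({1, Fin.revPerm} : Set (Equiv.Perm (Fin 3)))) (a b : Fin 3) :
    domino (r a) (r b) = domino a b ∧ dominoExp (r a) (r b) = dominoExp a b := by
  rcases hr with rfl | rfl
  · exact ⟨rfl, rfl⟩
  · simp only [domino_apply]
    revert a b
    decide

/-- The sum of five numbers from `{0, 1, 6, 36}` determines them up to order. -/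
theorem exists_perm_of_sum_eq {s s' : Fin 5 → ℕ} (hs : ∀ t, s t = 0 ∨ s t = 1 ∨ s t = 6 ∨ s t = 36)
    (hs' : ∀ t, s' t = 0 ∨ s' t = 1 ∨ s' t = 6 ∨ s' t = 36) (h : ∑ t, s t = ∑ t, s' t) :
    ∃ p : Equiv.Perm (Fin 5), ∀ t, s' (p t) = s t := by
  let c : (Fin 5 → ℕ) → ℕ → ℕ := fun s x => ∑ t, if s t = x then 1 else 0
  have hsum : ∀ s : Fin 5 → ℕ, (∀ t, s t = 0 ∨ s t = 1 ∨ s t = 6 ∨ s t = 36) →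
      ∑ t, s t = c s 1 + 6 * c s 6 + 36 * c s 36 ∧ 5 = c s 0 + c s 1 + c s 6 + c s 36 ∧
        ∀ x, x ≠ 0 → x ≠ 1 → x ≠ 6 → x ≠ 36 → c s x = 0 := by
    intro s hs
    refine ⟨?_, ?_, fun x h0 h1 h6 h36 => Finset.sum_eq_zero fun t _ => ?_⟩
    · simp only [c, Finset.mul_sum, ← Finset.sum_add_distrib]
      refine Finset.sum_congr rfl fun t _ => ?_
      rcases hs t with h | h | h | h <;> simp [h]
    · have : (5 : ℕ) = ∑ t : Fin 5, 1 := by simp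
      rw [this]
      simp only [c, ← Finset.sum_add_distrib]
      refine Finset.sum_congr rfl fun t _ => ?_
      rcases hs t with h | h | h | h <;> simp [h]
    · rcases hs t with h | h | h | h <;> rw [h, if_neg] <;> omega
  obtain ⟨h1, h2, h3⟩ := hsum s hs
  obtain ⟨h1', h2', h3'⟩ := hsum s' hs'
  have hc : ∀ x, c s x = c s' x := by
    -- The counts are at most 5, so those of 1, 6 and 36 are the base 6 digits of the sum; the count
    -- of 0 is what remains of 5.
    have e1 : c s 1 = c s' 1 := by omega
    have e6 : c s 6 = c s' 6 := by omega
    have : c s 0 = c s' 0 ∧ c s 1 = c s' 1 ∧ c s 6 = c s' 6 ∧ c s 36 = c s' 36 := by omega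
    intro x
    by_cases hx : x = 0 ∨ x = 1 ∨ x = 6 ∨ x = 36
    · rcases hx with rfl | rfl | rfl | rfl
      exacts [this.1, this.2.1, this.2.2.1, this.2.2.2]
    · push Not at hx
      rw [h3 x hx.1 hx.2.1 hx.2.2.1 hx.2.2.2, h3' x hx.1 hx.2.1 hx.2.2.1 hx.2.2.2]
  have he : ∀ x, Nonempty ({t // s t = x} ≃ {t // s' t = x}) := fun x => by
    refine ⟨Fintype.equivOfCardEq ?_⟩
    rw [Fintype.card_subtype, Fintype.card_subtype, Finset.card_filter, Finset.card_filter]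
    exact hc x
  exact ⟨Equiv.ofFiberEquiv fun x => (he x).some, fun t => Equiv.ofFiberEquiv_map _ t⟩

/-- The invariant of positions of the fifth power that separates the orbits of ones. -/
def powInvariant (i j : Fin 5 → Fin 3) : ℕ × ℕ := (kronPow domino 5 i j, powExp i j)

/-- Equal label sums match the coordinates up to a permutation, and matched coordinates agree up to
reversal. The same map acts on rows and columns. The entry is part of the invariant because zeros of
the Domino matrix carry label 0 too. -/
theorem exists_aut_of_powInvariant_eq (i j i' j' : Fin 5 → Fin 3) (h : kronPow domino 5 i j = 1)
    (hv : powInvariant i j = powInvariant i' j') :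
    ∃ p ∈ autGroup powInvariant, p.1 i = i' ∧ p.2 j = j' := by
  obtain ⟨h1, h2⟩ := Prod.ext_iff.1 hv
  have h' : kronPow domino 5 i' j' = 1 := h1.symm.trans h
  obtain ⟨p, hp⟩ := exists_perm_of_sum_eq (fun t => dominoExp_mem (i t) (j t))
    (fun t => dominoExp_mem (i' t) (j' t)) h2
  choose r hr hri hrj using fun t => exists_perm_of_dominoExp_eq (i t) (j t) (i' (p t)) (j' (p t))
    (kronPow_eq_one_iff.1 h t) (kronPow_eq_one_iff.1 h' (p t)) (hp t).symm
  let e : Equiv.Perm (Fin 5 → Fin 3) :=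
    (Equiv.piCongrRight r).trans (p.arrowCongr (Equiv.refl (Fin 3)))
  have he : ∀ x t, e x t = r (p.symm t) (x (p.symm t)) := fun x t => rfl
  refine ⟨(e, e), fun x y => Prod.ext ?_ ?_, funext fun t => ?_, funext fun t => ?_⟩
  · simp only [powInvariant, kronPow, he]
    rw [Equiv.prod_comp p.symm fun t => domino (r t (x t)) (r t (y t))]
    exact Finset.prod_congr rfl fun t _ => (domino_perm (hr t) _ _).1
  · simp only [powInvariant, powExp, he]
    rw [Equiv.sum_comp p.symm fun t => dominoExp (r t (x t)) (r t (y t))]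
    exact Finset.sum_congr rfl fun t _ => (domino_perm (hr t) _ _).2
  · rw [he, hri, Equiv.apply_symm_apply]
  · rw [he, hrj, Equiv.apply_symm_apply]

/-- The generating function is multiplicative over coordinates. One factor counts two corner ones,
two ones with each of the labels 1 and 6, and the centre. -/
theorem sum_kronPow_domino_mul_pow (b : ℕ) :
    ∑ e : (Fin 5 → Fin 3) × (Fin 5 → Fin 3), kronPow domino 5 e.1 e.2 * b ^ powExp e.1 e.2 =
      (2 + 2 * b + 2 * b ^ 6 + b ^ 36) ^ 5 := by
  have h : 2 + 2 * b + 2 * b ^ 6 + b ^ 36 =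
      ∑ a, ∑ c, domino a c * b ^ dominoExp a c := by
    simp [Fin.sum_univ_three, domino, dominoExp]
    ring
  rw [h, ← Fin.prod_const, Finset.prod_univ_sum, Fintype.piFinset_univ, Fintype.sum_prod_type]
  refine Finset.sum_congr rfl fun i _ => ?_
  rw [Finset.prod_univ_sum, Fintype.piFinset_univ]
  refine Finset.sum_congr rfl fun j _ => ?_
  rw [kronPow, powExp, Finset.prod_mul_distrib, Finset.prod_pow_eq_pow_sum]

/-- The ternary digits of a number, least significant first. -/
def ternary (a : ℕ) : Fin 5 → Fin 3 := fun t => ⟨a / 3 ^ (t : ℕ) % 3, Nat.mod_lt _ (by norm_num)⟩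

theorem ternary_injOn {a b : ℕ} (ha : a < 243) (hb : b < 243) (h : ternary a = ternary b) :
    a = b := by
  have h' : ∀ t : Fin 5, a / 3 ^ (t : ℕ) % 3 = b / 3 ^ (t : ℕ) % 3 := fun t =>
    congrArg Fin.val (congrFun h t)
  have h0 := h' 0
  have h1 := h' 1
  have h2 := h' 2
  have h3 := h' 3
  have h4 := h' 4
  simp only [Fin.isValue, Fin.coe_ofNat_eq_mod, Nat.reduceMod, Nat.reducePow] at h0 h1 h2 h3 h4
  omega

/-- The weight `domino a b * (2 ^ 60) ^ dominoExp a b` of two ternary digits. -/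
def digitWeight (a b : ℕ) : ℕ :=
  -- Here `2160 = 60 * 36` and `360 = 60 * 6`. The form with `bif` and `Nat.beq` suits kernel
  -- evaluation.
  bif Nat.beq a 1 then (bif Nat.beq b 1 then 2 ^ 2160 else 2 ^ 360)
  else bif Nat.beq b 1 then 2 ^ 60 else bif Nat.beq a b then 1 else 0

/-- The product of the weights of the ternary digits. -/
def codeWeight (a b : ℕ) : ℕ :=
  digitWeight (a % 3) (b % 3) * digitWeight (a / 3 % 3) (b / 3 % 3) *
    digitWeight (a / 9 % 3) (b / 9 % 3) * digitWeight (a / 27 % 3) (b / 27 % 3) *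
    digitWeight (a / 81 % 3) (b / 81 % 3)

theorem digitWeight_eq (a b : Fin 3) :
    digitWeight a b = domino a b * (2 ^ 60) ^ dominoExp a b := by
  fin_cases a <;> fin_cases b <;> decide +kernel

theorem codeWeight_eq (a b : ℕ) : codeWeight a b =
    kronPow domino 5 (ternary a) (ternary b) * (2 ^ 60) ^ powExp (ternary a) (ternary b) := by
  rw [kronPow, powExp, ← Finset.prod_pow_eq_pow_sum, ← Finset.prod_mul_distrib,
    Fin.prod_univ_five]
  simp only [← digitWeight_eq]
  simp [codeWeight, ternary]

theorem kronPow_of_codeWeight_ne_zero {a b : ℕ} (h : codeWeight a b ≠ 0) :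
    kronPow domino 5 (ternary a) (ternary b) = 1 := by
  refine (isBinary_domino.kronPow 5 _ _).resolve_left fun h0 => h ?_
  rw [codeWeight_eq, h0, zero_mul]

theorem codeWeight_eq_pow {a b : ℕ} (h : codeWeight a b ≠ 0) :
    codeWeight a b = (2 ^ 60) ^ powExp (ternary a) (ternary b) := by
  rw [codeWeight_eq, kronPow_of_codeWeight_ne_zero h, one_mul]

/-- `S` and `T` are duplicate-free lists of codes of the rows and columns of a biclique. -/
def IsBicliqueCode (S T : List ℕ) : Prop :=
  (S ≠ [] ∧ S.Nodup ∧ ∀ a ∈ S, a < 243) ∧ (T ≠ [] ∧ T.Nodup ∧ ∀ b ∈ T, b < 243) ∧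
    -- Both orders are required so that the transposed rectangle is a biclique as well.
    ∀ a ∈ S, ∀ b ∈ T, codeWeight a b ≠ 0 ∧ codeWeight b a ≠ 0

instance (S T : List ℕ) : Decidable (IsBicliqueCode S T) := by
  unfold IsBicliqueCode
  infer_instance

theorem IsBicliqueCode.symm {S T : List ℕ} (h : IsBicliqueCode S T) : IsBicliqueCode T S :=
  ⟨h.2.1, h.1, fun b hb a ha => (h.2.2 a ha b hb).symm⟩

/-- The sum of the weights over a rectangle. -/
def rectWeight (S T : List ℕ) : ℕ := (S.map fun a => (T.map fun b => codeWeight a b).sum).sum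

/-- The biclique with a given code. -/
def IsBicliqueCode.biclique {S T : List ℕ} (h : IsBicliqueCode S T) :
    Biclique (kronPow domino 5) :=
  ⟨((S.map ternary).toFinset, (T.map ternary).toFinset),
    by simpa using h.1.1, by simpa using h.2.1.1, by
      intro i hi j hj
      simp only [List.mem_toFinset, List.mem_map] at hi hj
      obtain ⟨a, ha, rfl⟩ := hi
      obtain ⟨b, hb, rfl⟩ := hj
      exact kronPow_of_codeWeight_ne_zero (h.2.2 a ha b hb).1⟩

theorem sum_toFinset_map_ternary {S : List ℕ} (hS : S.Nodup) (hlt : ∀ a ∈ S, a < 243)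
    (f : (Fin 5 → Fin 3) → ℕ) :
    ∑ i ∈ (S.map ternary).toFinset, f i = (S.map fun a => f (ternary a)).sum := by
  rw [List.sum_toFinset f (hS.map_on fun a ha b hb => ternary_injOn (hlt a ha) (hlt b hb)),
    List.map_map]
  rfl

theorem IsBicliqueCode.sum_pow {S T : List ℕ} (h : IsBicliqueCode S T) :
    ∑ i ∈ h.biclique.1.1, ∑ j ∈ h.biclique.1.2, (2 ^ 60) ^ powExp i j = rectWeight S T := by
  rw [rectWeight, IsBicliqueCode.biclique, sum_toFinset_map_ternary h.1.2.1 h.1.2.2]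
  congr 1
  refine List.map_congr_left fun a ha => ?_
  rw [sum_toFinset_map_ternary h.2.1.2.1 h.2.1.2.2]
  congr 1
  exact List.map_congr_left fun b hb => (codeWeight_eq_pow (h.2.2 a ha b hb).1).symm

open Classical in
theorem sum_covers_mul {m n : Type*} [Fintype m] [Fintype n] {A : Matrix m n ℕ} (B : Biclique A)
    (x : ℕ) (y : m → n → ℕ) : ∑ e : m × n, (if Covers B e then x else 0) * y e.1 e.2 =
      x * ∑ i ∈ B.1.1, ∑ j ∈ B.1.2, y i j := by
  rw [← Finset.sum_product', Finset.mul_sum]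
  symm
  refine Finset.sum_subset_zero_on_sdiff (Finset.subset_univ _) (fun e he => ?_) fun e he => ?_
  · rw [if_neg, zero_mul]
    exact fun hc => (Finset.mem_sdiff.1 he).2 (Finset.mem_product.2 hc)
  · rw [if_pos (show Covers B e from Finset.mem_product.1 he)]

open Classical in
/-- A criterion for a list of weighted bicliques, together with their transposes, to symmetrize to
a fractional partition of the fifth power of the Domino matrix. -/
theorem bpF_kronPow_domino_le (L : List (ℕ × List ℕ × List ℕ)) {Q : ℕ} (hQ : 0 < Q)
    (hL : ∀ c ∈ L, IsBicliqueCode c.2.1 c.2.2)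
    (hsum : (L.map fun c => c.1 * (rectWeight c.2.1 c.2.2 + rectWeight c.2.2 c.2.1)).sum =
      2 * Q * (2 + 2 * 2 ^ 60 + 2 * (2 ^ 60) ^ 6 + (2 ^ 60) ^ 36) ^ 5)
    (hsmall : 2 * (L.map fun c => c.1).sum * 243 ^ 2 < 2 ^ 60) (hQsmall : 2 * Q * 243 ^ 2 < 2 ^ 60) :
    bpF (kronPow domino 5) ≤ ((L.map fun c => c.1).sum : ℕ) / Q := by
  let X : Fin L.length × Bool → ℕ := fun c => L[c.1].1
  -- Transposition is not a pair of a row and a column permutation, so it is built in here by using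
  -- each rectangle in both orientations; hence the factor 2 in `2 * Q`.
  let b : Fin L.length × Bool → Biclique (kronPow domino 5) := fun c =>
    if c.2 then (hL L[c.1] (List.getElem_mem _)).biclique
    else (hL L[c.1] (List.getElem_mem _)).symm.biclique
  have hX : ∑ c, X c = 2 * (L.map fun c => c.1).sum := by
    rw [Fintype.sum_prod_type, ← Fin.sum_univ_fun_getElem, Finset.mul_sum]
    exact Finset.sum_congr rfl fun c _ => by simp [X, two_mul]
  let E := (Fin 5 → Fin 3) × (Fin 5 → Fin 3)
  have hE : Fintype.card E = 243 ^ 2 := by simp [E]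
  let f : E → ℕ := fun e => ∑ c, if Covers (b c) e then X c else 0
  let g : E → ℕ := fun e => 2 * Q * kronPow domino 5 e.1 e.2
  have hbin := isBinary_domino.kronPow 5
  have hf : ∑ e, f e < 2 ^ 60 := by
    refine lt_of_le_of_lt ?_ hsmall
    have : ∀ e ∈ (Finset.univ : Finset E), f e ≤ 2 * (L.map fun c => c.1).sum := fun e _ => by
      rw [← hX]
      exact Finset.sum_le_sum fun c _ => by split_ifs <;> simp
    simpa [hE, mul_comm] using Finset.sum_le_card_nsmul _ _ _ this
  have hg : ∑ e, g e < 2 ^ 60 := by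
    refine lt_of_le_of_lt ?_ hQsmall
    have : ∀ e ∈ (Finset.univ : Finset E), g e ≤ 2 * Q := fun e _ => by
      rcases hbin e.1 e.2 with h | h <;> simp [g, h]
    simpa [hE, mul_comm] using Finset.sum_le_card_nsmul _ _ _ this
  have hfg : ∑ e, f e * (2 ^ 60) ^ powExp e.1 e.2 = ∑ e, g e * (2 ^ 60) ^ powExp e.1 e.2 := by
    have h1 : ∑ e, g e * (2 ^ 60) ^ powExp e.1 e.2 =
        2 * Q * (2 + 2 * 2 ^ 60 + 2 * (2 ^ 60) ^ 6 + (2 ^ 60) ^ 36) ^ 5 := by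
      rw [← sum_kronPow_domino_mul_pow, Finset.mul_sum]
      exact Finset.sum_congr rfl fun e _ => mul_assoc _ _ _
    have h2 : ∀ c, ∑ e : E, (if Covers (b c) e then X c else 0) * (2 ^ 60) ^ powExp e.1 e.2 =
        X c * ∑ i ∈ (b c).1.1, ∑ j ∈ (b c).1.2, (2 ^ 60) ^ powExp i j := fun c =>
      sum_covers_mul (b c) (X c) fun i j => (2 ^ 60) ^ powExp i j
    rw [h1, ← hsum]
    simp only [f, Finset.sum_mul]
    rw [Finset.sum_comm, Finset.sum_congr rfl fun c _ => h2 c, Fintype.sum_prod_type,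
      ← Fin.sum_univ_fun_getElem]
    refine Finset.sum_congr rfl fun c _ => ?_
    rw [Fintype.sum_bool, mul_add]
    simp only [b, X, if_true, Bool.false_eq_true, if_false, IsBicliqueCode.sum_pow]
    rfl
  -- The total masses are below `2^60`, so no carries occur and the identity splits into one
  -- equation per exponent.
  have hfiber := sum_fiber_eq_of_sum_mul_pow_eq f g (fun e => powExp e.1 e.2) hf hg hfg
  have hQ' : (0 : ℝ) < 2 * Q := by positivity
  have key := bpF_le_of_average (A := kronPow domino 5) powInvariant
    (fun i j i' j' h => congrArg Prod.fst h) exists_aut_of_powInvariant_eq b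
    (fun c => (X c : ℝ) / (2 * Q)) (fun c => div_nonneg (Nat.cast_nonneg _) hQ'.le) fun i j hij => by
      have hF : ∀ e, ∑ c, (if Covers (b c) e then (X c : ℝ) / (2 * Q) else 0) =
          (f e : ℝ) / (2 * Q) := fun e => by
        simp only [f, Nat.cast_sum, Finset.sum_div, Nat.cast_ite, Nat.cast_zero, ite_div, zero_div]
      have hsupp : ∀ e : E, kronPow domino 5 e.1 e.2 ≠ 1 → f e = 0 := fun e he =>
        Finset.sum_eq_zero fun c _ => if_neg fun hc => he ((b c).2.2.2 _ hc.1 _ hc.2)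
      have hset : (Finset.univ.filter fun e : E => powInvariant e.1 e.2 = powInvariant i j) =
          (Finset.univ.filter fun e : E => powExp e.1 e.2 = powExp i j).filter
            fun e => kronPow domino 5 e.1 e.2 = 1 := by
        ext e
        simp [powInvariant, hij, and_comm]
      have h1 : ∑ e : E with powInvariant e.1 e.2 = powInvariant i j, f e =
          ∑ e : E with powExp e.1 e.2 = powExp i j, f e := by
        rw [hset]
        exact Finset.sum_filter_of_ne fun e _ h => by_contra fun he => h (hsupp e he)
      have h2 : ∑ e : E with powExp e.1 e.2 = powExp i j, g e = 2 * Q *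
          (Finset.univ.filter fun e : E => powInvariant e.1 e.2 = powInvariant i j).card := by
        rw [hset, Finset.card_filter, Finset.mul_sum]
        refine Finset.sum_congr rfl fun e _ => ?_
        rcases hbin e.1 e.2 with h | h <;> simp [g, h]
      rw [Finset.sum_congr rfl fun e _ => hF e, ← Finset.sum_div, ← Nat.cast_sum, h1, hfiber, h2]
      push_cast
      field_simp
      rfl
  refine key.trans (le_of_eq ?_)
  rw [← Finset.sum_div, ← Nat.cast_sum, hX]
  push_cast
  field_simp

/-- Weighted bicliques of the fifth power of the Domino matrix. -/
def dominoCertificate : List (ℕ × List ℕ × List ℕ) :=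
  [(52268684796, [106, 121, 124, 130, 133, 184, 185, 187, 188, 202, 205, 206, 211, 212, 214,
     215], [94, 95, 97, 98, 104, 106, 107, 122, 124, 125, 176, 179, 185, 188, 206]),
   (69739834501, [5, 8, 59, 62, 85, 86, 88, 89, 95, 97, 98, 139, 140, 142, 143, 149, 151, 152],
     [31, 32, 34, 35, 40, 41, 43, 44, 115, 121, 124, 125]),
   (37634422613, [13, 14, 16, 17, 26, 41, 43, 44, 53, 95, 97, 98, 107], [13, 14, 16, 22, 23, 25,
     26, 40, 49, 50, 52, 53, 94, 103, 104, 106, 107, 130]),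
   (6843040334, [109, 112, 118, 136, 190, 193, 199, 202, 217, 220, 226], [108, 110, 135, 137,
     138, 140, 144, 146, 147, 149, 192, 194, 198, 200, 216, 218, 219, 221, 225, 227, 228, 230]),
   (3428491832, [93, 94, 97, 121, 124, 174, 175, 177, 178, 201, 202, 204, 205], [84, 87, 88,
     102, 105, 106, 114, 115, 132, 133, 168, 186, 195, 213]),
   (6088433174, [103, 104, 106, 107, 121, 124, 125, 130, 131, 133, 134, 187, 188, 205, 206, 214,
     215], [94, 95, 103, 104, 122, 175, 176, 178, 179, 184, 185, 188, 202, 203, 205, 206]),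
   (21351706072, [0, 2, 9, 11, 27, 29, 36, 38, 81, 83, 84, 86, 90, 92, 108, 110], [1, 4, 10, 13,
     28, 31, 37, 40, 82, 85, 94, 112]),
   (58606071796, [85, 88, 97, 115, 166, 169, 175, 178, 193, 196, 205], [84, 86, 87, 89, 96, 98,
     114, 116, 165, 167, 168, 170, 174, 176, 177, 179, 192, 194, 195, 197, 204, 206]),
   (50475274932, [30, 31, 39, 57, 58, 66, 138, 139, 147], [27, 28, 33, 34, 36, 37, 42, 43, 54,
     55, 60, 61, 63, 69, 109, 115, 117, 118, 123, 124, 135, 136, 141, 142, 144, 145, 150, 151]),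
   (8721249291, [108, 109, 111, 112, 118, 135, 136, 145, 189, 190, 192, 193, 199, 216, 217,
     226], [111, 120, 135, 138, 144, 145, 147, 148, 192, 201, 202, 216, 219, 225, 226, 228,
     229]),
   (20080679352, [22, 23, 25, 26, 40, 41, 43, 44, 49, 50, 52, 53, 104, 106, 107, 122, 124, 125,
     131, 133, 134], [14, 16, 17, 23, 25, 26, 41, 43, 44, 98, 107, 125]),
   (3695531757, [85, 88, 97, 115, 166, 169, 175, 178, 193, 196, 205], [84, 86, 87, 89, 96, 98,
     114, 116, 120, 122, 165, 167, 168, 170, 174, 176, 177, 179, 192, 194, 195, 197, 204, 206]),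
   (4054466001, [125, 149, 151, 152, 202, 203, 205, 206, 229, 230, 232, 233], [116, 134, 140,
     142, 143, 158, 160, 161, 193, 194, 196, 197, 211, 212, 214, 215, 220, 221, 223, 224, 238,
     239, 241, 242]),
   (25334351078, [101, 155, 173, 181, 182, 185, 227, 235, 236, 239], [118, 119, 121, 122, 127,
     128, 130, 131, 199, 200, 202, 203, 208, 209, 211, 212]),
   (20582281277, [27, 28, 30, 31, 36, 37, 39, 40, 108, 109, 111, 112, 117, 118, 120], [0, 1, 3,
     4, 9, 10, 12, 54, 55, 57, 58, 63, 64, 66, 81, 82, 84, 90, 135, 136, 138, 144]),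
   (9468751600, [5, 7, 8, 17, 35, 167, 169, 170, 179, 197], [85, 86, 88, 89, 94, 95, 97, 98,
     112, 113, 115, 116, 122, 124, 125]),
   (22979147, [93, 96, 97, 105, 120, 121, 123, 124, 129, 132, 133, 177, 186, 201, 204, 205,
     213], [94, 102, 103, 106, 130, 174, 175, 178, 183, 184, 186, 187, 202, 210, 211, 214]),
   (49219668927, [120, 121, 129, 130, 147, 148, 156, 157, 201, 210, 228, 237, 238], [154, 160,
     198, 204, 207, 208, 213, 214, 225, 226, 231, 232, 234, 235, 240, 241]),
   (25371157428, [31, 32, 34, 35, 40, 41, 43, 44, 112, 115, 121, 122, 124, 125], [5, 8, 59, 62,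
     85, 86, 88, 89, 95, 98, 139, 140, 142, 143, 149, 152]),
   (40216612784, [95, 97, 98, 107, 125, 175, 176, 178, 179, 184, 185, 187, 188, 205, 206], [107,
     125, 131, 133, 134, 184, 185, 187, 188, 205, 206, 211, 212, 214, 215]),
   (491957151, [120, 121], [0, 1, 6, 7, 18, 19, 24, 25, 54, 55, 60, 61, 72, 73, 78, 79, 162,
     163, 168, 169, 180, 181, 186, 187, 216, 217, 222, 223, 234, 235, 240, 241]),
   (485970864, [0, 2, 6, 8, 18, 20, 24, 26, 40, 54, 56, 60, 62, 72, 74, 78, 80, 94, 112, 118,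
     120, 122, 124, 130, 148, 162, 164, 168, 170, 180, 182, 186, 188, 202, 216, 218, 222, 224,
     234, 236, 240, 242], [121]),
   (29088643696, [31, 32, 34, 35, 112, 113, 115, 116, 122, 124, 125], [5, 7, 8, 13, 14, 16, 17,
     59, 61, 62, 67, 68, 70, 71, 95, 97, 98, 149, 151, 152]),
   (10000000000, [118, 121, 145, 148], [27, 29, 30, 32, 45, 47, 48, 50, 54, 56, 57, 59, 72, 74,
     75, 77, 121, 145, 189, 191, 192, 194, 207, 209, 210, 212, 216, 218, 219, 221, 234, 236,
     237, 239]),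
   (13896891638, [5, 7, 8, 14, 17, 34, 35, 43, 44, 85, 86, 88, 89], [5, 7, 8, 14, 17, 34, 35,
     43, 44, 85, 86, 88, 89]),
   (18065991976, [0, 1, 9, 10, 27, 28, 30, 31, 36, 37, 39, 40, 90, 91, 117, 118, 120], [0, 1, 3,
     4, 30, 31, 81, 82, 84, 85, 90, 91, 93, 94, 111, 112, 120]),
   (18437285370, [105, 132, 133, 177, 183, 186, 204, 205, 210, 211, 213, 214], [94, 96, 97, 102,
     103, 105, 106, 124, 130, 133, 174, 175, 177, 178, 183, 184, 186, 187, 202, 205, 211, 214]),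
   (14955709112, [81, 82, 84, 85, 99, 100, 102, 103, 135, 136, 138, 139, 153, 154, 156, 157,
     162, 163, 165, 166, 180, 181, 183, 184, 198, 216, 217, 219, 220, 234, 235, 237, 238], [117,
     118, 120, 121, 198, 199, 201, 202]),
   (6079385456, [112, 121, 139, 148], [27, 29, 33, 35, 36, 38, 42, 44, 54, 56, 60, 62, 63, 65,
     69, 71, 139, 189, 191, 195, 197, 198, 200, 204, 206, 216, 218, 222, 224, 225, 227, 231,
     233]),
   (37804545063, [30, 33, 42, 57, 58, 60, 61, 66, 69, 70, 114, 141, 142], [30, 33, 42, 57, 58,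
     60, 61, 66, 69, 70, 114, 141, 142]),
   (29665323226, [93, 94, 96, 102, 103, 105, 106, 120, 129, 130, 174, 177, 183, 186, 201, 210],
     [106, 130, 133, 177, 178, 186, 187, 201, 202, 204, 205, 210, 211, 213, 214]),
   (22740728762, [31, 32, 34, 35, 112, 113, 115, 116, 122, 124, 125], [4, 5, 7, 8, 13, 14, 16,
     17, 58, 59, 61, 62, 67, 68, 70, 71, 95, 97, 98, 149, 151, 152]),
   (23552593162, [90, 93, 94, 99, 100, 102, 103, 120, 121, 126, 129, 130, 171, 172, 174, 175,
     180, 181, 183, 184, 198, 201, 202, 207, 208, 210, 211], [99, 171, 180, 181, 207]),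
   (13544308402, [94, 100, 101, 103, 104, 130, 131, 172, 173, 175, 176, 181, 182, 184, 185, 199,
     202, 208, 211, 212], [101, 128, 131, 173, 182, 199, 200, 208, 209, 212]),
   -- The one-cell bicliques, of weight at most 408 against `Q = 10^10`, make up exactly the small
   -- orbit deficits left by the rectangles above.
   (6, [0], [0]),
   (54, [0], [1]),
   (10, [1], [1]),
   (117, [0], [4]),
   (104, [1], [3]),
   (100, [1], [4]),
   (11, [4], [4]),
   (130, [0], [13]),
   (348, [1], [12]),
   (188, [1], [13]),
   (182, [4], [10]),
   (107, [4], [13]),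
   (9, [13], [13]),
   (85, [0], [40]),
   (256, [1], [39]),
   (158, [1], [40]),
   (190, [4], [36]),
   (408, [4], [37]),
   (134, [4], [40]),
   (94, [13], [31]),
   (42, [13], [40]),
   (2, [40], [40]),
   (29, [0], [121]),
   (83, [1], [120]),
   (36, [1], [121]),
   (136, [4], [117]),
   (166, [4], [118]),
   (35, [4], [121]),
   (100, [13], [109]),
   (123, [13], [112]),
   (15, [13], [121]),
   (22, [40], [94]),
   (9, [40], [121])]

theorem bpF_kronPow_domino_le_certificate : bpF (kronPow domino 5) ≤ 752013026059 / 10 ^ 10 := by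
  have h := bpF_kronPow_domino_le dominoCertificate (Q := 10 ^ 10) (by norm_num)
    (by decide +kernel) (by decide +kernel) (by decide +kernel) (by norm_num)
  have hs : (dominoCertificate.map fun c => c.1).sum = 752013026059 := by decide +kernel
  rw [hs] at h
  exact_mod_cast h

theorem bpFInf_domino_le : bpFInf domino ≤ 2.372713 := by
  refine (bpFInf_le_rpow domino (k := 5) (by norm_num)).trans ?_
  rw [one_div, Real.rpow_inv_le_iff_of_pos (bpF_nonneg _) (by norm_num) (by norm_num),
    Real.rpow_natCast]
  -- Numerically, `75.2013026059 ≤ 2.372713 ^ 5`, the latter being about `75.20142`.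
  exact bpF_kronPow_domino_le_certificate.trans (by norm_num)

end Domino

end BinMat

theorem theorem1 :
    (∀ (m n : ℕ) (A : Matrix (Fin m) (Fin n) ℕ), BinMat.IsBinary A →
      Tendsto (fun k : ℕ => BinMat.bpF (BinMat.kronPow A k) ^ (1 / (k : ℝ))) atTop
        (𝓝 (BinMat.bpFInf A)) ∧
      (BinMat.isoNum A : ℝ) ≤ BinMat.bcF A ∧
      BinMat.bcF A ≤ BinMat.bpFInf A ∧
      BinMat.bpFInf A ≤ BinMat.bpF A ∧
      BinMat.bpF A ≤ BinMat.bp A) ∧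
    2 ≤ BinMat.bpFInf BinMat.domino ∧
    BinMat.bpFInf BinMat.domino ≤ 2.372713 := by
  refine ⟨fun m n A _ => ⟨BinMat.tendsto_bpFInf A, BinMat.isoNum_le_bcF A, BinMat.bcF_le_bpFInf A,
    BinMat.bpFInf_le_bpF A, BinMat.bpF_le_bp A⟩, ?_, BinMat.bpFInf_domino_le⟩
  refine le_trans ?_ ((BinMat.isoNum_le_bcF _).trans (BinMat.bcF_le_bpFInf _))
  exact_mod_cast BinMat.two_le_isoNum_domino
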